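/- Setting. Consider $x_{k+1}=Ax_k+Bu_k+w(x_k)$ with $x_k\in\mathbb R^n$, $u_k\in\mathbb R^m$ and disturbance support $[\tilde w_1,\tilde w_2]\subseteq\mathbb R^n$ (a box), a feedback gain $K$, a state box $[\tilde x_1,\tilde x_2]\subseteq\mathbb R^n$, and a tolerance $\varepsilon\in(0,1]$. At time $t$ let $x_{0|t}=x_t$ be the state, $s_{0|t},v_{0|t}$ the nominal state and input, $s_{1|t}=As_{0|t}+Bv_{0|t}$, and $$x_{1|t}=(A+BK)x_{0|t}-BKs_{0|t}+Bv_{0|t}+w(x_{0|t}).$$ For each $\tau\in\{1,\dots,n\}$ let a Gaussian mixture with $M_\tau$ components, weights $\gamma_{\tau,j}\ge 0$ with $\sum_j\gamma_{\tau,j}=1$, means $\mu_{\tau,j}\in[\tilde w_1^{(\tau)},\tilde w_2^{(\tau)}]$ and variances $\Sigma_{\tau,j}\ge 0$ be the predictive distribution of $w(x_{0|t})^{(\tau)}$. Let $\mathcal W_{\tau,j}$ be the set of Borel probability measures on $[\tilde w_1^{(\tau)},\tilde w_2^{(\tau)}]$ with mean $\mu_{\tau,j}$ and second moment about $\mu_{\tau,j}$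 at most $\Sigma_{\tau,j}$, let $\mathcal W_\tau=\sum_j\gamma_{\tau,j}\mathcal W_{\tau,j}=\{\sum_j\gamma_{\tau,j}\rho_j:\rho_j\in\mathcal W_{\tau,j}\}$, and let $Q_\tau$ be the set of laws of $x_{1|t}^{(\tau)}$ obtained when the law of $w(x_{0|t})^{(\tau)}$ ranges over $\mathcal W_\tau$ (the corresponding shift of $\mathcal W_\tau$). Write $\mathbb Q\text{-CVaR}_\varepsilon(L)=\inf_{\beta\in\mathbb R}\{\beta+\tfrac1\varepsilon\mathbb E_{\mathbb Q}(L-\beta)^+\}$. Theorem. For all $\tau\in\{1,\dots,n\}$ and $i\in\{1,2\}$, the DR-CVaR constraint $$\sup_{\mathbb Q\in Q_\tau}\mathbb Q\text{-CVaR}_\varepsilon\{(-1)^i(x_{1|t}^{(\tau)}-\tilde x_i^{(\tau)})\}\le 0\qquad(1)$$ holds if and only if $$(-1)^i\Big[s_{1|t}^{(\tau)}+\big((A+BK)(x_t-s_{0|t})\big)^{(\tau)}\Big]\le(-1)^i\tilde x_i^{(\tau)}-\eta_{i,t}^{(\tau)},$$ where $\eta_{i,t}^{(\tau)}$ is the (finite)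 optimal value of the second-order cone program that minimizes $\eta$ over $\eta,\beta\in\mathbb R$ and $t_j,\omega_j,\Omega_j,\varphi_{1,j},\varphi_{2,j},\phi_{1,j},\phi_{2,j}\in\mathbb R$ $(1\le j\le M_\tau)$ subject to $$\varepsilon\beta+\sum_{j=1}^{M_\tau}\gamma_{\tau,j}\big\{t_j+\mu_{\tau,j}\omega_j+[\Sigma_{\tau,j}+\mu_{\tau,j}^2]\Omega_j\big\}\le 0$$ and, for all $j$, $\Omega_j,\varphi_{1,j},\varphi_{2,j},\phi_{1,j},\phi_{2,j}\ge 0$, $$\left\|\begin{pmatrix}\omega_j+\varphi_{1,j}-\varphi_{2,j}\\ \Omega_j-t_j+\tilde w_2^{(\tau)}\varphi_{1,j}-\tilde w_1^{(\tau)}\varphi_{2,j}\end{pmatrix}\right\|_2\le \Omega_j+t_j-\tilde w_2^{(\tau)}\varphi_{1,j}+\tilde w_1^{(\tau)}\varphi_{2,j},$$ $$\left\|\begin{pmatrix}\omega_j-(-1)^i+\phi_{1,j}-\phi_{2,j}\\ \Omega_j-t_j-\beta-\eta+\tilde w_2^{(\tau)}\phi_{1,j}-\tilde w_1^{(\tau)}\phi_{2,j}\end{pmatrix}\right\|_2\le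 \Omega_j+t_j+\beta+\eta-\tilde w_2^{(\tau)}\phi_{1,j}+\tilde w_1^{(\tau)}\phi_{2,j}.$$ The optimal value is attained (it is a minimum) whenever $\Sigma_{\tau,j}>0$ for all $j$. Moreover, all $2n$ constraints (1) hold if and only if $$s_{1|t}+(A+BK)(x_t-s_{0|t})\in[\tilde x_1+\eta_{1,t},\ \tilde x_2-\eta_{2,t}]$$ (componentwise box), where $\eta_{i,t}=(\eta_{i,t}^{(1)},\dots,\eta_{i,t}^{(n)})$. -/

import Mathlib

open MeasureTheory Matrix

noncomputable section

/-- The data of a one-dimensional Gaussian mixture `∑ j, γ j • 𝒩(μ j, variance j)` with `M`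
components, used as predictive distribution of one coordinate of the disturbance. -/
structure GaussianMixture where
  M : ℕ
  γ : Fin M → ℝ
  μ : Fin M → ℝ
  variance : Fin M → ℝ
  γ_nonneg : ∀ j, 0 ≤ γ j
  γ_sum : ∑ j, γ j = 1
  variance_nonneg : ∀ j, 0 ≤ variance j

/-- The two sides `i = 1, 2` are indexed by `Fin 2` (so `i = 0` is the lower side and `i = 1` the
upper side); `sideSign i` is the sign `-1` on the lower side and `+1` on the upper side. -/
def sideSign (i : Fin 2) : ℝ := (-1) ^ ((i : ℕ) + 1)

/-- Local moment ambiguity set: the positive Borel measures on `ℝ` that live on `[lo, hi]`,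
have total mass one, mean `m`, and second moment about `m` at most `v`. -/
def localAmbiguitySet (lo hi m v : ℝ) : Set (Measure ℝ) :=
  {ρ | ρ (Set.Icc lo hi)ᶜ = 0 ∧ ρ (Set.Icc lo hi) = 1 ∧
    ∫ ξ in Set.Icc lo hi, ξ ∂ρ = m ∧ ∫ ξ in Set.Icc lo hi, (ξ - m) ^ 2 ∂ρ ≤ v}

/-- The weighted Minkowski sum `∑ j, γ j • 𝒲 j` of the local ambiguity sets of a mixture. -/
def disturbanceAmbiguitySet (lo hi : ℝ) (G : GaussianMixture) : Set (Measure ℝ) :=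
  {P | ∃ ρ : Fin G.M → Measure ℝ,
    (∀ j, ρ j ∈ localAmbiguitySet lo hi (G.μ j) (G.variance j)) ∧
    P = ∑ j, ENNReal.ofReal (G.γ j) • ρ j}

/-- The ambiguity set of `c + w` when the law of `w` ranges over `𝒲`. -/
def shiftedAmbiguitySet (c : ℝ) (𝒲 : Set (Measure ℝ)) : Set (Measure ℝ) :=
  (fun P => P.map (fun w => c + w)) '' 𝒲

/-- Conditional value-at-risk at level `ε` of the loss `L` under the law `Q`,
`inf_β { β + ε⁻¹ 𝔼_Q (L - β)⁺ }`. The infimum is taken in the extended reals. -/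
def cvar (Q : Measure ℝ) (ε : ℝ) (L : ℝ → ℝ) : EReal :=
  ⨅ β : ℝ, ((β + ε⁻¹ * ∫ y, max (L y - β) 0 ∂Q : ℝ) : EReal)

/-- The worst-case CVaR constraint `sup_{Q ∈ 𝒬} Q-CVaR_ε (L) ≤ 0`. -/
def DRCVaRConstraint (𝒬 : Set (Measure ℝ)) (ε : ℝ) (L : ℝ → ℝ) : Prop :=
  (⨆ Q ∈ 𝒬, cvar Q ε L) ≤ 0

/-- Decision variables, other than the objective variable `η`, of the second-order cone program. -/
structure SOCPVars (M : ℕ) where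
  β : ℝ
  t : Fin M → ℝ
  ω : Fin M → ℝ
  Ω : Fin M → ℝ
  varphi₁ : Fin M → ℝ
  varphi₂ : Fin M → ℝ
  phi₁ : Fin M → ℝ
  phi₂ : Fin M → ℝ

/-- The constraints of the second-order cone program, for the mixture `G`, the support
`[lo, hi]`, the level `ε` and the side `i`. -/
def SOCPFeasible (G : GaussianMixture) (lo hi ε : ℝ) (i : Fin 2) (η : ℝ)
    (d : SOCPVars G.M) : Prop :=
  ε * d.β + ∑ j, G.γ j *
      (d.t j + G.μ j * d.ω j + (G.variance j + G.μ j ^ 2) * d.Ω j) ≤ 0 ∧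
  ∀ j,
    ‖(!₂[d.ω j + d.varphi₁ j - d.varphi₂ j,
        d.Ω j - d.t j + hi * d.varphi₁ j - lo * d.varphi₂ j] : EuclideanSpace ℝ (Fin 2))‖
      ≤ d.Ω j + d.t j - hi * d.varphi₁ j + lo * d.varphi₂ j ∧
    ‖(!₂[d.ω j - sideSign i + d.phi₁ j - d.phi₂ j,
        d.Ω j - d.t j - d.β - η + hi * d.phi₁ j - lo * d.phi₂ j] : EuclideanSpace ℝ (Fin 2))‖
      ≤ d.Ω j + d.t j + d.β + η - hi * d.phi₁ j + lo * d.phi₂ j ∧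
    0 ≤ d.Ω j ∧ 0 ≤ d.varphi₁ j ∧ 0 ≤ d.varphi₂ j ∧ 0 ≤ d.phi₁ j ∧ 0 ≤ d.phi₂ j

/-- The objective values `η` attained at feasible points of the second-order cone program. -/
def socpValues (G : GaussianMixture) (lo hi ε : ℝ) (i : Fin 2) : Set ℝ :=
  {η | ∃ d : SOCPVars G.M, SOCPFeasible G lo hi ε i η d}

/-- The tightening: the optimal value of the second-order cone program. -/
def tightening (G : GaussianMixture) (lo hi ε : ℝ) (i : Fin 2) : ℝ :=
  sInf (socpValues G lo hi ε i)

/-- The constraint `sup_{Q ∈ Q_τ(x₁)} Q-CVaR_ε {(-1)^i (x₁^(τ) - x̃_i^(τ))} ≤ 0` on the coordinate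
`τ` of the first predicted state
`x₁ = (A + B K) x₀ - B K s₀ + B v₀ + w(x₀)`. Here `wb 0, wb 1` and `xb 0, xb 1` are the lower and
upper corners of the disturbance support and of the state box, and `pred x τ` is the predictive
mixture of `w(x)^(τ)`. -/
def firstStateDRCVaR {n m : ℕ} (A : Matrix (Fin n) (Fin n) ℝ) (B : Matrix (Fin n) (Fin m) ℝ)
    (K : Matrix (Fin m) (Fin n) ℝ) (wb xb : Fin 2 → Fin n → ℝ)
    (pred : (Fin n → ℝ) → Fin n → GaussianMixture) (ε : ℝ)
    (x₀ s₀ : Fin n → ℝ) (v₀ : Fin m → ℝ) (τ : Fin n) (i : Fin 2) : Prop :=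
  DRCVaRConstraint
    (shiftedAmbiguitySet (((A + B * K) *ᵥ x₀ - (B * K) *ᵥ s₀ + B *ᵥ v₀) τ)
      (disturbanceAmbiguitySet (wb 0 τ) (wb 1 τ) (pred x₀ τ)))
    ε (fun y => sideSign i * (y - xb i τ))

end

/-! CVaR is translation equivariant, so (1) compares a shift with one number `V`, the worst-case
CVaR of the signed disturbance `s * w`; the point is that `V` is the value of the cone program. By
`mem_socpValues_iff` the cones encode, per component, a convex quadratic dominating the hinge loss
on the support. Integrating such quadratics against the moment bounds gives weak duality
(`exists_cvar_le_of_mem_socpValues`). For the converse, fix the CVaR level and one component. A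
two-point law and an explicit quadratic touching the hinge at its atoms have the same value, up to
an arbitrarily small slack if the variance vanishes (`exists_majorant_le_twoPoint`, a Scarf bound on
an interval). With `p` the upper mass and `h` the first moment it carries, these laws form a compact
convex set on which the objective is affine, as it is in the level. Sion's theorem yields a saddle
point: its law is worst for all levels, its level feeds the cone program (`exists_worst_case`). -/

/-! ### Rotated cones and quadratics nonnegative on an interval. -/

/-- A rotated second-order cone constraint is a hyperbolic constraint. -/
theorem norm_le_iff_hyperbolic {a Ω T : ℝ} (hΩ : 0 ≤ Ω) :
    ‖(!₂[a, Ω - T] : EuclideanSpace ℝ (Fin 2))‖ ≤ Ω + T ↔ 0 ≤ T ∧ a ^ 2 ≤ 4 * Ω * T := by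
  rw [EuclideanSpace.norm_eq, Real.sqrt_le_iff]
  simp only [Fin.sum_univ_two, Real.norm_eq_abs, sq_abs, Matrix.cons_val_zero,
    Matrix.cons_val_one]
  constructor
  · rintro ⟨h1, h2⟩
    have h3 : a ^ 2 ≤ 4 * Ω * T := by nlinarith
    refine ⟨?_, h3⟩
    by_contra! hT
    rcases hΩ.eq_or_lt with h | h
    · linarith
    · nlinarith [sq_nonneg a, mul_pos h (neg_pos.2 hT)]
  · rintro ⟨h1, h2⟩
    exact ⟨by linarith, by nlinarith⟩

theorem quadratic_nonneg_of_hyperbolic {a Ω T : ℝ} (hΩ : 0 ≤ Ω) (hT : 0 ≤ T)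
    (h : a ^ 2 ≤ 4 * Ω * T) (x : ℝ) : 0 ≤ T + a * x + Ω * x ^ 2 := by
  rcases hΩ.eq_or_lt with rfl | hpos
  · have : a = 0 := by nlinarith
    simp [this, hT]
  · have : 0 ≤ 4 * Ω * (T + a * x + Ω * x ^ 2) := by nlinarith [sq_nonneg (2 * Ω * x + a)]
    by_contra! hneg
    nlinarith

/-- Multipliers certifying that a convex quadratic is nonnegative on an interval. -/
theorem exists_multipliers_of_quadratic_nonneg {lo hi T ω Ω : ℝ} (hlo : lo ≤ hi) (hΩ : 0 ≤ Ω)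
    (h : ∀ x ∈ Set.Icc lo hi, 0 ≤ T + ω * x + Ω * x ^ 2) :
    ∃ φ₁ φ₂ : ℝ, 0 ≤ φ₁ ∧ 0 ≤ φ₂ ∧ 0 ≤ T - hi * φ₁ + lo * φ₂ ∧
      (ω + φ₁ - φ₂) ^ 2 ≤ 4 * Ω * (T - hi * φ₁ + lo * φ₂) := by
  -- The multipliers are the KKT ones: the inward slope at the endpoint where the quadratic is
  -- minimal, or zero when the minimiser is interior.
  rcases le_or_gt 0 (2 * Ω * lo + ω) with h1 | h1
  · have := h lo ⟨le_rfl, hlo⟩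
    refine ⟨0, 2 * Ω * lo + ω, le_rfl, h1, ?_, ?_⟩
    · nlinarith [mul_nonneg hΩ (sq_nonneg lo)]
    · nlinarith [mul_nonneg hΩ this]
  rcases le_or_gt (2 * Ω * hi + ω) 0 with h2 | h2
  · have := h hi ⟨hlo, le_rfl⟩
    refine ⟨-(2 * Ω * hi + ω), 0, by linarith, le_rfl, ?_, ?_⟩
    · nlinarith [mul_nonneg hΩ (sq_nonneg hi)]
    · nlinarith [mul_nonneg hΩ this]
  have hpos : 0 < Ω := by
    rcases hΩ.eq_or_lt with rfl | hp
    · linarith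
    · exact hp
  have hx := h (-ω / (2 * Ω)) ⟨by rw [le_div_iff₀ (by positivity)]; linarith,
    by rw [div_le_iff₀ (by positivity)]; linarith⟩
  have hval : T + ω * (-ω / (2 * Ω)) + Ω * (-ω / (2 * Ω)) ^ 2 = (4 * Ω * T - ω ^ 2) / (4 * Ω) := by
    field_simp
    ring
  rw [hval, le_div_iff₀ (by positivity), zero_mul] at hx
  refine ⟨0, 0, le_rfl, le_rfl, ?_, by linarith⟩
  have : 0 ≤ 4 * Ω * T := by nlinarith [sq_nonneg ω]
  simpa using nonneg_of_mul_nonneg_right this (by positivity)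

/-! ### Two-point laws and quadratic majorants of the hinge. -/

/-- The quadratic `t + ω x + Ω x²` is convex and dominates `max 0 (x + κ)` on `[-l, r]`. -/
def IsHingeMajorant (l r κ t ω Ω : ℝ) : Prop :=
  0 ≤ Ω ∧ ∀ x ∈ Set.Icc (-l) r, 0 ≤ t + ω * x + Ω * x ^ 2 ∧ x + κ ≤ t + ω * x + Ω * x ^ 2

/-- Pairs `(p, h)` encoding the centred two-point laws with mass `p` at `h / p` and mass `1 - p` at
`-h / (1 - p)`, supported in `[-l, r]` and with variance at most `v`. -/
def twoPointSet (l r v : ℝ) : Set (ℝ × ℝ) :=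
  {y | 0 ≤ y.1 ∧ y.1 ≤ 1 ∧ 0 ≤ y.2 ∧ y.2 ≤ y.1 * r ∧ y.2 ≤ (1 - y.1) * l ∧
    y.2 ^ 2 ≤ v * (y.1 * (1 - y.1))}

/-- In the variance constraint `h ^ 2` is convex and `p * (1 - p)` concave; `e3` and `e4` below are
the two convexity defects. -/
theorem convex_twoPointSet {l r v : ℝ} (hv : 0 ≤ v) : Convex ℝ (twoPointSet l r v) := by
  rintro ⟨p, h⟩ ⟨h1, h2, h3, h4, h5, h6⟩ ⟨q, k⟩ ⟨k1, k2, k3, k4, k5, k6⟩ a b ha hb hab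
  obtain rfl : b = 1 - a := by linarith
  simp only [twoPointSet, Set.mem_ofPred_eq, Prod.smul_mk, Prod.mk_add_mk, smul_eq_mul] at *
  refine ⟨by positivity, by nlinarith, by positivity, by nlinarith, by nlinarith, ?_⟩
  have e1 := mul_le_mul_of_nonneg_left h6 ha
  have e2 := mul_le_mul_of_nonneg_left k6 hb
  have e3 := mul_nonneg (mul_nonneg ha hb) (sq_nonneg (h - k))
  have e4 := mul_nonneg hv (mul_nonneg (mul_nonneg ha hb) (sq_nonneg (p - q)))
  nlinarith

theorem isCompact_twoPointSet {l r v : ℝ} (hr : 0 ≤ r) : IsCompact (twoPointSet l r v) := by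
  refine (isCompact_Icc (a := ((0 : ℝ), (0 : ℝ))) (b := (1, r))).of_isClosed_subset ?_ ?_
  · simp only [twoPointSet, Set.ofPred_and]
    refine IsClosed.inter ?_ (IsClosed.inter ?_ (IsClosed.inter ?_ (IsClosed.inter ?_
      (IsClosed.inter ?_ ?_)))) <;> exact isClosed_le (by fun_prop) (by fun_prop)
  · rintro ⟨p, h⟩ ⟨h1, h2, h3, h4, -, -⟩
    simp only [] at *
    exact ⟨⟨h1, h3⟩, ⟨h2, by simp only []; nlinarith⟩⟩

/-- The parabola is `(x + κ + S)² / (4S)`, tangent to `0` at `-κ - S` and to `x + κ` at `-κ + S`. -/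
theorem isHingeMajorant_scarf {l r κ S v : ℝ} (hS : 0 < S) (h : S ^ 2 = κ ^ 2 + v) :
    IsHingeMajorant l r κ ((S + κ) ^ 2 / (4 * S)) ((S + κ) / (2 * S)) (1 / (4 * S)) ∧
      (S + κ) ^ 2 / (4 * S) + v * (1 / (4 * S)) = (S + κ) / 2 := by
  have key : ∀ x, (S + κ) ^ 2 / (4 * S) + (S + κ) / (2 * S) * x + 1 / (4 * S) * x ^ 2
      = (x + S + κ) ^ 2 / (4 * S) := fun x => by field_simp; ring
  refine ⟨⟨by positivity, fun x _ => ?_⟩, ?_⟩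
  · rw [key]
    refine ⟨by positivity, ?_⟩
    rw [le_div_iff₀ (by positivity)]
    nlinarith [sq_nonneg (x + κ - S)]
  · obtain rfl : v = S ^ 2 - κ ^ 2 := by linarith
    field_simp
    ring

/-- Duality between two-point laws and quadratic majorants of the hinge loss. -/
theorem exists_majorant_le_twoPoint {l r v δ : ℝ} (κ : ℝ) (hl : 0 ≤ l) (hr : 0 ≤ r) (hv : 0 ≤ v)
    (hδ : 0 ≤ δ) (hvδ : v = 0 → 0 < δ) :
    ∃ y ∈ twoPointSet l r v, ∃ t ω Ω : ℝ, IsHingeMajorant l r κ t ω Ω ∧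
      t + v * Ω ≤ y.2 + κ * y.1 + δ := by
  -- If the kink `-κ` is not interior to `[-l, r]`, the hinge is affine there and is its own
  -- majorant.
  rcases le_or_gt κ (-r) with h1 | h1
  · refine ⟨(0, 0), by simp [twoPointSet, hl], 0, 0, 0, ⟨le_rfl, fun x hx => ?_⟩, by simpa⟩
    have := hx.2
    constructor <;> linarith
  rcases le_or_gt l κ with h2 | h2
  · refine ⟨(1, 0), by simp [twoPointSet, hr], κ, 1, 0, ⟨le_rfl, fun x hx => ?_⟩, by simpa⟩
    have := hx.1
    constructor <;> linarith
  have hrl : 0 < r + l := by linarith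
  rcases hv.eq_or_lt with rfl | hv0
  · have hδ0 := hvδ rfl
    -- The only law is the point mass at `0`. For `κ = 0` no parabola touches the kink from above,
    -- so the infimum may fail to be attained; the slack `δ` pays for widening the parabola.
    set S := |κ| + δ with hSdef
    have hκ := abs_nonneg κ
    have hS : 0 < S := by positivity
    obtain ⟨hm, -⟩ := isHingeMajorant_scarf (l := l) (r := r) (κ := κ) (v := S ^ 2 - κ ^ 2) hS
      (by ring)
    have hval : (S + κ) ^ 2 / (4 * S) ≤ (S + κ) / 2 := by
      have h3 := neg_abs_le κ
      have h4 := le_abs_self κ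
      rw [div_le_div_iff₀ (by positivity) (by positivity)]
      nlinarith [mul_nonneg (show 0 ≤ S + κ by linarith) (show 0 ≤ S - κ by linarith)]
    rcases le_total 0 κ with hk | hk
    · refine ⟨(1, 0), by simp [twoPointSet, hr], _, _, _, hm, ?_⟩
      rw [abs_of_nonneg hk] at hSdef
      simp only []
      linarith
    · refine ⟨(0, 0), by simp [twoPointSet, hl], _, _, _, hm, ?_⟩
      rw [abs_of_nonpos hk] at hSdef
      simp only []
      linarith
  suffices H : ∃ y ∈ twoPointSet l r v, ∃ t ω Ω : ℝ, IsHingeMajorant l r κ t ω Ω ∧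
      t + v * Ω ≤ y.2 + κ * y.1 by
    obtain ⟨y, hy, t, ω, Ω, h3, h4⟩ := H
    exact ⟨y, hy, t, ω, Ω, h3, by linarith⟩
  -- A centred law on `[-l, r]` has variance at most `r * l`, so here the bound is inactive: the law
  -- sits on the endpoints and the majorant is the chord.
  rcases le_or_gt (r * l) v with h3 | h3
  · refine ⟨(l / (r + l), r * l / (r + l)), ⟨by positivity, ?_, by positivity, ?_, ?_, ?_⟩,
      (r + κ) * l / (r + l), (r + κ) / (r + l), 0, ⟨le_rfl, fun x hx => ?_⟩, ?_⟩
    · rw [div_le_one hrl]; linarith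
    · exact le_of_eq (by simp only []; field_simp)
    · exact le_of_eq (by simp only []; field_simp; ring)
    · have e : v * (l / (r + l) * (1 - l / (r + l))) = v * (r * l) / (r + l) ^ 2 := by
        field_simp; ring
      simp only []
      rw [e, div_pow]
      gcongr
      nlinarith [mul_nonneg hr hl]
    · have e : (r + κ) * l / (r + l) + (r + κ) / (r + l) * x + 0 * x ^ 2
          = (r + κ) * (x + l) / (r + l) := by field_simp; ring
      have h5 := hx.1
      have h6 := hx.2
      rw [e]
      refine ⟨div_nonneg (mul_nonneg (by linarith) (by linarith)) hrl.le, ?_⟩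
      rw [le_div_iff₀ hrl]
      nlinarith [mul_nonneg (show 0 ≤ r - x by linarith) (show 0 ≤ l - κ by linarith)]
    · exact le_of_eq (by simp only []; field_simp; ring)
  have hr0 : 0 < r := by
    rcases hr.eq_or_lt with rfl | h
    · linarith
    · exact h
  have hl0 : 0 < l := by
    rcases hl.eq_or_lt with rfl | h
    · linarith
    · exact h
  rcases le_or_gt ((r + κ) ^ 2) (κ ^ 2 + v) with h4 | h4
  · -- the upper support point is the right end of the interval
    have hb : v / r ≤ l := by rw [div_le_iff₀ hr0]; linarith
    refine ⟨(v / (r ^ 2 + v), v * r / (r ^ 2 + v)), ⟨by positivity, ?_, by positivity, ?_, ?_, ?_⟩,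
      (r + κ) * v ^ 2 / (r ^ 2 + v) ^ 2, 2 * (r + κ) * (v * r) / (r ^ 2 + v) ^ 2,
      (r + κ) * r ^ 2 / (r ^ 2 + v) ^ 2,
      ⟨div_nonneg (mul_nonneg (by linarith) (by positivity)) (by positivity), fun x hx => ?_⟩, ?_⟩
    · rw [div_le_one (by positivity)]; nlinarith
    · exact le_of_eq (by simp only []; field_simp)
    · have e : (1 - v / (r ^ 2 + v)) * l = r * (r * l) / (r ^ 2 + v) := by field_simp; ring
      simp only []
      rw [e, mul_comm v r]
      gcongr
    · refine le_of_eq ?_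
      simp only []
      field_simp
      ring
    · have e : (r + κ) * v ^ 2 / (r ^ 2 + v) ^ 2 + 2 * (r + κ) * (v * r) / (r ^ 2 + v) ^ 2 * x
          + (r + κ) * r ^ 2 / (r ^ 2 + v) ^ 2 * x ^ 2
          = (r + κ) * (r * x + v) ^ 2 / (r ^ 2 + v) ^ 2 := by field_simp; ring
      have h6 := hx.2
      rw [e]
      refine ⟨div_nonneg (mul_nonneg (by linarith) (by positivity)) (by positivity), ?_⟩
      rw [le_div_iff₀ (by positivity)]
      -- `h7` and `h8` add up to the cleared difference between the parabola and `x + κ`; the last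
      -- factor of `h7` is `h4` rearranged.
      have h7 : 0 ≤ (r - x) * (r ^ 2 + v) * (v - r ^ 2 - 2 * κ * r) :=
        mul_nonneg (mul_nonneg (by linarith) (by positivity)) (by nlinarith)
      have h8 : 0 ≤ (r + κ) * (r * (r - x)) ^ 2 := mul_nonneg (by linarith) (by positivity)
      nlinarith
    · refine le_of_eq ?_
      simp only []
      field_simp
      ring
  -- Mirror case: atoms `-l` and `v / l`, with the parabola tangent to `x + κ` at the latter.
  rcases le_or_gt ((l - κ) ^ 2) (κ ^ 2 + v) with h5 | h5
  · refine ⟨(l ^ 2 / (l ^ 2 + v), v * l / (l ^ 2 + v)),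
      ⟨by positivity, ?_, by positivity, ?_, ?_, ?_⟩,
      (l - κ) * v ^ 2 / (l ^ 2 + v) ^ 2 + κ, 1 - 2 * (l - κ) * (v * l) / (l ^ 2 + v) ^ 2,
      (l - κ) * l ^ 2 / (l ^ 2 + v) ^ 2,
      ⟨div_nonneg (mul_nonneg (by linarith) (by positivity)) (by positivity), fun x hx => ?_⟩, ?_⟩
    · rw [div_le_one (by positivity)]; nlinarith
    · have e : l ^ 2 / (l ^ 2 + v) * r = (r * l) * l / (l ^ 2 + v) := by field_simp
      simp only []
      rw [e]
      gcongr
    · exact le_of_eq (by simp only []; field_simp; ring)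
    · refine le_of_eq ?_
      simp only []
      field_simp
      ring
    · have e : (l - κ) * v ^ 2 / (l ^ 2 + v) ^ 2 + κ
          + (1 - 2 * (l - κ) * (v * l) / (l ^ 2 + v) ^ 2) * x
          + (l - κ) * l ^ 2 / (l ^ 2 + v) ^ 2 * x ^ 2
          = (l - κ) * (v - l * x) ^ 2 / (l ^ 2 + v) ^ 2 + (x + κ) := by field_simp; ring
      have h6 := hx.1
      rw [e]
      refine ⟨neg_le_iff_add_nonneg.1 ?_, le_add_of_nonneg_left
        (div_nonneg (mul_nonneg (by linarith) (by positivity)) (by positivity))⟩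
      rw [le_div_iff₀ (by positivity)]
      have h7 : 0 ≤ (l + x) * (l ^ 2 + v) * (v - l ^ 2 + 2 * κ * l) :=
        mul_nonneg (mul_nonneg (by linarith) (by positivity)) (by nlinarith)
      have h8 : 0 ≤ (l - κ) * (l * (l + x)) ^ 2 := mul_nonneg (by linarith) (by positivity)
      nlinarith
    · refine le_of_eq ?_
      simp only []
      field_simp
      ring
  -- Both Scarf contact points now lie inside the interval and serve as the atoms.
  obtain ⟨S, hS0, hS⟩ : ∃ S : ℝ, 0 < S ∧ S ^ 2 = κ ^ 2 + v :=
    ⟨√(κ ^ 2 + v), by positivity, Real.sq_sqrt (by positivity)⟩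
  obtain ⟨hm, hval⟩ := isHingeMajorant_scarf (l := l) (r := r) (κ := κ) hS0 hS
  obtain rfl : v = S ^ 2 - κ ^ 2 := by linarith
  have h6 : S < r + κ := by nlinarith
  have h7 : S < l - κ := by nlinarith
  have h8 : |κ| < S := abs_lt_of_sq_lt_sq (by linarith) hS0.le
  obtain ⟨h9, h10⟩ := abs_lt.1 h8
  refine ⟨((S + κ) / (2 * S), (S ^ 2 - κ ^ 2) / (2 * S)), ⟨?_, ?_, ?_, ?_, ?_, ?_⟩, _, _, _, hm, ?_⟩
  · exact div_nonneg (by linarith) (by linarith)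
  · rw [div_le_one (by positivity)]; linarith
  · exact div_nonneg (by linarith) (by linarith)
  · have e : (S + κ) / (2 * S) * r = (S + κ) * r / (2 * S) := by ring
    simp only []
    rw [e]
    gcongr
    nlinarith
  · have e : (1 - (S + κ) / (2 * S)) * l = (S - κ) * l / (2 * S) := by field_simp; ring
    simp only []
    rw [e]
    gcongr
    nlinarith
  · refine le_of_eq ?_
    simp only []
    field_simp
    ring
  · rw [hval]
    refine le_of_eq ?_
    simp only []
    field_simp
    ring

/-! ### Moment bounds and two-point members of the local ambiguity set. -/

section LocalAmbiguity

variable {lo hi m v : ℝ} {ρ : Measure ℝ}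

theorem isProbabilityMeasure_of_mem_localAmbiguitySet (h : ρ ∈ localAmbiguitySet lo hi m v) :
    IsProbabilityMeasure ρ := by
  refine ⟨?_⟩
  rw [← measure_add_measure_compl (measurableSet_Icc (a := lo) (b := hi)), h.1, h.2.1, add_zero]

theorem ae_mem_of_mem_localAmbiguitySet (h : ρ ∈ localAmbiguitySet lo hi m v) :
    ∀ᵐ ξ ∂ρ, ξ ∈ Set.Icc lo hi := h.1

theorem restrict_eq_of_mem_localAmbiguitySet (h : ρ ∈ localAmbiguitySet lo hi m v) :
    ρ.restrict (Set.Icc lo hi) = ρ :=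
  Measure.restrict_eq_self_of_ae_mem (ae_mem_of_mem_localAmbiguitySet h)

theorem integrable_of_mem_localAmbiguitySet (h : ρ ∈ localAmbiguitySet lo hi m v) {f : ℝ → ℝ}
    (hf : Continuous f) : Integrable f ρ := by
  have := isProbabilityMeasure_of_mem_localAmbiguitySet h
  have := hf.continuousOn.integrableOn_compact (μ := ρ) (isCompact_Icc (a := lo) (b := hi))
  rwa [IntegrableOn, restrict_eq_of_mem_localAmbiguitySet h] at this

theorem integral_hinge_le_of_mem_localAmbiguitySet (h : ρ ∈ localAmbiguitySet lo hi m v)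
    {t ω Ω s c : ℝ} (hΩ : 0 ≤ Ω)
    (hq : ∀ ξ ∈ Set.Icc lo hi, 0 ≤ t + ω * ξ + Ω * ξ ^ 2 ∧ s * ξ - c ≤ t + ω * ξ + Ω * ξ ^ 2) :
    ∫ ξ, max (s * ξ - c) 0 ∂ρ ≤ t + m * ω + (v + m ^ 2) * Ω := by
  have := isProbabilityMeasure_of_mem_localAmbiguitySet h
  have hint {f : ℝ → ℝ} (hf : Continuous f) := integrable_of_mem_localAmbiguitySet h hf
  obtain ⟨-, -, h1, h2⟩ := id h
  rw [restrict_eq_of_mem_localAmbiguitySet h] at h1 h2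
  calc ∫ ξ, max (s * ξ - c) 0 ∂ρ
      -- Recentring at `m` lets the inequality on the second moment enter with the sign `0 ≤ Ω`.
      ≤ ∫ ξ, (t - Ω * m ^ 2) + (ω + 2 * Ω * m) * ξ + Ω * (ξ - m) ^ 2 ∂ρ := by
        refine integral_mono_ae (hint (by fun_prop)) (hint (by fun_prop)) ?_
        filter_upwards [ae_mem_of_mem_localAmbiguitySet h] with ξ hξ
        obtain ⟨h3, h4⟩ := hq ξ hξ
        exact max_le (by linarith) (by linarith)
    _ = (t - Ω * m ^ 2) + (ω + 2 * Ω * m) * m + Ω * ∫ ξ, (ξ - m) ^ 2 ∂ρ := by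
        rw [integral_add (hint (by fun_prop)) (hint (by fun_prop)),
          integral_add (hint (by fun_prop)) (hint (by fun_prop)), integral_const_mul,
          integral_const_mul, h1]
        simp
    _ ≤ t + m * ω + (v + m ^ 2) * Ω := by nlinarith

theorem smul_dirac_add_smul_dirac_mem_localAmbiguitySet {a b p : ℝ} (hp0 : 0 ≤ p) (hp1 : p ≤ 1)
    (ha : a ∈ Set.Icc lo hi) (hb : b ∈ Set.Icc lo hi) (hm : p * a + (1 - p) * b = m)
    (hv : p * (a - m) ^ 2 + (1 - p) * (b - m) ^ 2 ≤ v) :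
    ENNReal.ofReal p • Measure.dirac a + ENNReal.ofReal (1 - p) • Measure.dirac b ∈
      localAmbiguitySet lo hi m v := by
  have hint (f : ℝ → ℝ) : ∫ ξ in Set.Icc lo hi, f ξ ∂(ENNReal.ofReal p • Measure.dirac a
      + ENNReal.ofReal (1 - p) • Measure.dirac b) = p * f a + (1 - p) * f b := by
    have hdirac (x c : ℝ) : Integrable f (ENNReal.ofReal c • Measure.dirac x) :=
      (integrable_dirac (by simp)).smul_measure ENNReal.ofReal_ne_top
    rw [Measure.restrict_eq_self_of_ae_mem, integral_add_measure (hdirac _ _) (hdirac _ _)]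
    · simp [ENNReal.toReal_ofReal hp0, ENNReal.toReal_ofReal (sub_nonneg.2 hp1)]
    · rw [ae_add_measure_iff]
      constructor <;> refine Measure.ae_smul_measure ?_ _ <;> rw [ae_dirac_eq]
      exacts [ha, hb]
  refine ⟨?_, ?_, by rw [hint, hm], by rw [hint]; exact hv⟩
  · simp [measurableSet_Icc.compl, ha, hb]
  · simp only [Measure.coe_add, Measure.coe_smul, Pi.add_apply, Pi.smul_apply, smul_eq_mul,
      Measure.dirac_apply_of_mem ha, Measure.dirac_apply_of_mem hb, mul_one]
    rw [← ENNReal.ofReal_add hp0 (sub_nonneg.2 hp1)]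
    simp

/-- Every point of `twoPointSet` yields a law whose hinge moments it bounds from below. -/
theorem exists_mem_localAmbiguitySet_hinge_ge {s L U : ℝ} (hs : s ^ 2 = 1)
    (hS : ∀ ξ, ξ ∈ Set.Icc lo hi ↔ s * ξ ∈ Set.Icc L U) (hm : m ∈ Set.Icc lo hi) (hv : 0 ≤ v)
    {y : ℝ × ℝ} (hy : y ∈ twoPointSet (s * m - L) (U - s * m) v) :
    ∃ ρ ∈ localAmbiguitySet lo hi m v, ∀ β,
      y.2 + (s * m - β) * y.1 ≤ ∫ ξ, max (s * ξ - β) 0 ∂ρ ∧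
      s * m - β ≤ ∫ ξ, max (s * ξ - β) 0 ∂ρ := by
  obtain ⟨p, h⟩ := y
  obtain ⟨h1, h2, h3, h4, h5, h6⟩ := hy
  simp only [] at h1 h2 h3 h4 h5 h6 ⊢
  have hsm := (hS m).1 hm
  -- Atom offsets are `h / p` and `h / (1 - p)`; an atom of zero mass forces `h = 0` and gets offset
  -- `0`.
  obtain ⟨a, ha0, ha1, hpa⟩ : ∃ a, 0 ≤ a ∧ a ≤ U - s * m ∧ p * a = h := by
    rcases h1.eq_or_lt with rfl | hp
    · exact ⟨0, le_rfl, by linarith [hsm.2], by linarith⟩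
    · exact ⟨h / p, by positivity, by rw [div_le_iff₀ hp]; linarith, by field_simp⟩
  obtain ⟨b, hb0, hb1, hpb⟩ : ∃ b, 0 ≤ b ∧ b ≤ s * m - L ∧ (1 - p) * b = h := by
    rcases h2.eq_or_lt with rfl | hp
    · exact ⟨0, le_rfl, by linarith [hsm.1], by linarith⟩
    · have hp' : 0 < 1 - p := by linarith
      exact ⟨h / (1 - p), by positivity, by rw [div_le_iff₀ hp']; linarith, by field_simp⟩
  have hvar : p * a ^ 2 + (1 - p) * b ^ 2 ≤ v := by
    rcases (mul_nonneg h1 (sub_nonneg.2 h2)).eq_or_lt with hp | hp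
    · have hh : h = 0 := by rw [← hp] at h6; nlinarith
      have e : p * a ^ 2 + (1 - p) * b ^ 2 = a * (p * a) + b * ((1 - p) * b) := by ring
      rw [e, hpa, hpb, hh]
      simpa using hv
    · refine le_of_mul_le_mul_right ?_ hp
      calc _ = (p * a) ^ 2 * (1 - p) + ((1 - p) * b) ^ 2 * p := by ring
        _ = h ^ 2 := by rw [hpa, hpb]; ring
        _ ≤ _ := h6
  have hss : ∀ x, s * (s * x) = x := fun x => by rw [← mul_assoc, ← sq, hs, one_mul]
  have hρ := smul_dirac_add_smul_dirac_mem_localAmbiguitySet (v := v) h1 h2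
    ((hS (m + s * a)).2 (by
      rw [mul_add, hss]; exact ⟨by linarith [hsm.1], by linarith⟩))
    ((hS (m - s * b)).2 (by
      rw [mul_sub, hss]; exact ⟨by linarith, by linarith [hsm.2]⟩))
    (m := m) (by linear_combination s * hpa - s * hpb)
    (by
      calc _ = s ^ 2 * (p * a ^ 2 + (1 - p) * b ^ 2) := by ring
        _ ≤ v := by rw [hs, one_mul]; exact hvar)
  refine ⟨_, hρ, fun β => ⟨?_, ?_⟩⟩
  · have hdirac (x c : ℝ) : Integrable (fun ξ => max (s * ξ - β) 0)
        (ENNReal.ofReal c • Measure.dirac x) :=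
      (integrable_dirac (by simp)).smul_measure ENNReal.ofReal_ne_top
    rw [integral_add_measure (hdirac _ _) (hdirac _ _)]
    simp only [integral_smul_measure, integral_dirac, ENNReal.toReal_ofReal h1,
      ENNReal.toReal_ofReal (sub_nonneg.2 h2), smul_eq_mul]
    -- Take the affine branch at the upper atom and zero at the lower one: a bound affine in `(p,
    -- h)` and valid at every level.
    have e1 := mul_le_mul_of_nonneg_left (le_max_left (s * (m + s * a) - β) 0) h1
    have e2 := mul_nonneg (sub_nonneg.2 h2) (le_max_right (s * (m - s * b) - β) 0)
    rw [mul_add s, hss] at e1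
    rw [mul_add s, hss]
    linarith
  · have := isProbabilityMeasure_of_mem_localAmbiguitySet hρ
    have hint {f : ℝ → ℝ} (hf : Continuous f) := integrable_of_mem_localAmbiguitySet hρ hf
    obtain ⟨-, -, k1, -⟩ := id hρ
    rw [restrict_eq_of_mem_localAmbiguitySet hρ] at k1
    refine le_of_eq_of_le ?_ (integral_mono (f := fun ξ => s * ξ - β) (hint (by fun_prop))
      (hint (by fun_prop)) fun ξ => le_max_left _ _)
    rw [integral_sub (hint (by fun_prop)) (hint (by fun_prop)), integral_const_mul, k1]
    simp

end LocalAmbiguity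

/-! ### Mixtures, the cone program and its duality. -/

theorem integral_mixture {ι : Type*} [Fintype ι] {γ : ι → ℝ} (hγ : ∀ j, 0 ≤ γ j)
    {ρ : ι → Measure ℝ} {f : ℝ → ℝ} (hf : ∀ j, Integrable f (ρ j)) :
    ∫ x, f x ∂(∑ j, ENNReal.ofReal (γ j) • ρ j) = ∑ j, γ j * ∫ x, f x ∂(ρ j) := by
  rw [integral_finsetSum_measure fun j _ => (hf j).smul_measure ENNReal.ofReal_ne_top]
  simp [ENNReal.toReal_ofReal (hγ _)]

theorem norm_cone_iff {lo hi a Ω T φ₁ φ₂ : ℝ} (hΩ : 0 ≤ Ω) :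
    ‖(!₂[a, Ω - T + hi * φ₁ - lo * φ₂] : EuclideanSpace ℝ (Fin 2))‖
      ≤ Ω + T - hi * φ₁ + lo * φ₂ ↔
    0 ≤ T - hi * φ₁ + lo * φ₂ ∧ a ^ 2 ≤ 4 * Ω * (T - hi * φ₁ + lo * φ₂) := by
  rw [← norm_le_iff_hyperbolic hΩ]
  ring_nf

theorem quadratic_nonneg_of_multipliers {lo hi T ω Ω φ₁ φ₂ : ℝ} (hΩ : 0 ≤ Ω) (h₁ : 0 ≤ φ₁)
    (h₂ : 0 ≤ φ₂) (hT : 0 ≤ T - hi * φ₁ + lo * φ₂)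
    (h : (ω + φ₁ - φ₂) ^ 2 ≤ 4 * Ω * (T - hi * φ₁ + lo * φ₂)) {x : ℝ}
    (hx : x ∈ Set.Icc lo hi) : 0 ≤ T + ω * x + Ω * x ^ 2 := by
  have h3 := quadratic_nonneg_of_hyperbolic hΩ hT h x
  have h4 := mul_nonneg h₁ (sub_nonneg.2 hx.2)
  have h5 := mul_nonneg h₂ (sub_nonneg.2 hx.1)
  linarith

/-- The second-order cone program is a semi-infinite program over quadratic majorants of the
hinge loss on the support. -/
theorem mem_socpValues_iff {G : GaussianMixture} {lo hi ε η : ℝ} {i : Fin 2} (hlo : lo ≤ hi) :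
    η ∈ socpValues G lo hi ε i ↔ ∃ (β : ℝ) (t ω Ω : Fin G.M → ℝ),
      ε * β + ∑ j, G.γ j * (t j + G.μ j * ω j + (G.variance j + G.μ j ^ 2) * Ω j) ≤ 0 ∧
      ∀ j, 0 ≤ Ω j ∧ ∀ ξ ∈ Set.Icc lo hi, 0 ≤ t j + ω j * ξ + Ω j * ξ ^ 2 ∧
        sideSign i * ξ - (β + η) ≤ t j + ω j * ξ + Ω j * ξ ^ 2 := by
  constructor
  · rintro ⟨d, hd, hj⟩
    refine ⟨d.β, d.t, d.ω, d.Ω, hd, fun j => ?_⟩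
    obtain ⟨h1, h2, hΩ, h3, h4, h5, h6⟩ := hj j
    rw [norm_cone_iff hΩ] at h1
    rw [show d.Ω j - d.t j - d.β - η = d.Ω j - (d.t j + d.β + η) by ring,
      show d.Ω j + d.t j + d.β + η = d.Ω j + (d.t j + d.β + η) by ring, norm_cone_iff hΩ] at h2
    refine ⟨hΩ, fun ξ hξ => ⟨quadratic_nonneg_of_multipliers hΩ h3 h4 h1.1 h1.2 hξ, ?_⟩⟩
    linarith [quadratic_nonneg_of_multipliers hΩ h5 h6 h2.1 h2.2 hξ]
  · rintro ⟨β, t, ω, Ω, hd, hj⟩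
    choose φ₁ φ₂ a1 a2 a3 a4 using fun j =>
      exists_multipliers_of_quadratic_nonneg hlo (hj j).1 fun ξ hξ => ((hj j).2 ξ hξ).1
    choose ψ₁ ψ₂ b1 b2 b3 b4 using fun j =>
      exists_multipliers_of_quadratic_nonneg (T := t j + β + η) (ω := ω j - sideSign i) hlo
        (hj j).1 fun ξ hξ => by linarith [((hj j).2 ξ hξ).2]
    refine ⟨⟨β, t, ω, Ω, φ₁, φ₂, ψ₁, ψ₂⟩, hd, fun j =>
      ⟨(norm_cone_iff (hj j).1).2 ⟨a3 j, a4 j⟩, ?_, (hj j).1, a1 j, a2 j, b1 j, b2 j⟩⟩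
    rw [show Ω j - t j - β - η = Ω j - (t j + β + η) by ring,
      show Ω j + t j + β + η = Ω j + (t j + β + η) by ring]
    exact (norm_cone_iff (hj j).1).2 ⟨b3 j, b4 j⟩

/-- Weak duality. -/
theorem exists_cvar_le_of_mem_socpValues {G : GaussianMixture} {lo hi ε η : ℝ} {i : Fin 2}
    (hlo : lo ≤ hi) (hε : 0 < ε) (hη : η ∈ socpValues G lo hi ε i) :
    ∃ β : ℝ, ∀ P ∈ disturbanceAmbiguitySet lo hi G,
      β + ε⁻¹ * ∫ ξ, max (sideSign i * ξ - β) 0 ∂P ≤ η := by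
  obtain ⟨β, t, ω, Ω, hd, hj⟩ := (mem_socpValues_iff hlo).1 hη
  -- The program's `β` is the CVaR level minus the objective `η`.
  refine ⟨β + η, ?_⟩
  rintro P ⟨ρ, hρ, rfl⟩
  rw [integral_mixture G.γ_nonneg fun j =>
    integrable_of_mem_localAmbiguitySet (hρ j) (by fun_prop)]
  have h1 := Finset.sum_le_sum fun j (_ : j ∈ Finset.univ) => mul_le_mul_of_nonneg_left
    (integral_hinge_le_of_mem_localAmbiguitySet (hρ j) (hj j).1 (hj j).2) (G.γ_nonneg j)
  have h2 : ε⁻¹ * ∑ j, G.γ j * ∫ ξ, max (sideSign i * ξ - (β + η)) 0 ∂(ρ j) ≤ -β := by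
    rw [inv_mul_le_iff₀ hε]
    linarith
  linarith

/-- Strong duality: the value `V` is the conditional value-at-risk of a worst-case law and is
approached by feasible points, and attained if no component is degenerate. -/
theorem exists_worst_case {G : GaussianMixture} {lo hi ε L U : ℝ} {i : Fin 2}
    (hμ : ∀ j, G.μ j ∈ Set.Icc lo hi) (hε₀ : 0 < ε) (hε₁ : ε ≤ 1) (hs : sideSign i ^ 2 = 1)
    (hS : ∀ ξ, ξ ∈ Set.Icc lo hi ↔ sideSign i * ξ ∈ Set.Icc L U) (hLU : L ≤ U) (hlo : lo ≤ hi) :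
    ∃ V : ℝ, (∃ P ∈ disturbanceAmbiguitySet lo hi G, ∀ β : ℝ,
        V ≤ β + ε⁻¹ * ∫ ξ, max (sideSign i * ξ - β) 0 ∂P) ∧
      ∀ δ, 0 ≤ δ → ((∃ j, G.variance j = 0) → 0 < δ) → V + δ ∈ socpValues G lo hi ε i := by
  set s := sideSign i
  let C : Fin G.M → Set (ℝ × ℝ) := fun j =>
    twoPointSet (s * G.μ j - L) (U - s * G.μ j) (G.variance j)
  let f : ℝ → (Fin G.M → ℝ × ℝ) → ℝ := fun β y =>
    ε * β + ∑ j, G.γ j * ((y j).2 + (s * G.μ j - β) * (y j).1)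
  have hl j : 0 ≤ s * G.μ j - L := sub_nonneg.2 ((hS _).1 (hμ j)).1
  have hr j : 0 ≤ U - s * G.μ j := sub_nonneg.2 ((hS _).1 (hμ j)).2
  have hC : Convex ℝ (Set.univ.pi C) :=
    convex_pi fun j _ => convex_twoPointSet (G.variance_nonneg j)
  -- Levels are confined to the range `[L, U]` of the signed disturbance, for compactness.
  obtain ⟨b, hb, y, hy, hsad⟩ : ∃ b ∈ Set.Icc L U, ∃ y ∈ Set.univ.pi C,
      IsSaddlePointOn (Set.Icc L U) (Set.univ.pi C) f b y := by
    refine Sion.exists_isSaddlePointOn (Set.nonempty_Icc.2 hLU) (convex_Icc L U) isCompact_Icc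
      ?_ ?_ hC ⟨0, fun j _ => ?_⟩ (isCompact_univ_pi fun j => isCompact_twoPointSet (hr j)) ?_ ?_
    · intro y _
      exact (show Continuous fun β => f β y by fun_prop).continuousOn.lowerSemicontinuousOn
    · intro y _
      refine ConvexOn.quasiconvexOn ⟨convex_Icc L U, fun β _ β' _ c d _ _ hcd => le_of_eq ?_⟩
      obtain rfl : d = 1 - c := by linarith
      simp only [f, smul_eq_mul, mul_add, Finset.mul_sum]
      rw [add_add_add_comm, ← Finset.sum_add_distrib]
      congr 1
      · ring
      · exact Finset.sum_congr rfl fun j _ => by ring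
    · simp [C, twoPointSet, hl j]
    · intro β _
      exact (show Continuous (f β) by fun_prop).continuousOn.upperSemicontinuousOn
    · intro β _
      refine ConcaveOn.quasiconcaveOn ⟨hC, fun y _ z _ c d _ _ hcd => le_of_eq ?_⟩
      obtain rfl : d = 1 - c := by linarith
      simp only [f, smul_eq_mul, mul_add, Finset.mul_sum, Pi.add_apply, Pi.smul_apply,
        Prod.fst_add, Prod.snd_add, Prod.smul_fst, Prod.smul_snd]
      rw [add_add_add_comm, ← Finset.sum_add_distrib]
      congr 1
      · ring
      · exact Finset.sum_congr rfl fun j _ => by ring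
  refine ⟨ε⁻¹ * f b y, ?_, fun δ hδ hδ' => ?_⟩
  · choose ρ hρ hρ' using fun j => exists_mem_localAmbiguitySet_hinge_ge hs hS (hμ j)
      (G.variance_nonneg j) (hy j (Set.mem_univ j))
    refine ⟨_, ⟨ρ, hρ, rfl⟩, fun β => ?_⟩
    rw [integral_mixture G.γ_nonneg fun j =>
      integrable_of_mem_localAmbiguitySet (hρ j) (by fun_prop), inv_mul_le_iff₀ hε₀, mul_add,
      mul_inv_cancel_left₀ hε₀.ne']
    -- Levels outside `[L, U]` are compared with the nearest endpoint `β₀`, with `e` absorbing the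
    -- change in `ε * β`.
    have hbound (β₀ : ℝ) (hβ₀ : β₀ ∈ Set.Icc L U) {e : ℝ}
        (he : ε * β₀ + e ≤ ε * β)
        (hg : ∀ j, (y j).2 + (s * G.μ j - β₀) * (y j).1
          ≤ e + ∫ ξ, max (s * ξ - β) 0 ∂(ρ j)) :
        f b y ≤ ε * β + ∑ j, G.γ j * ∫ ξ, max (s * ξ - β) 0 ∂(ρ j) := by
      have h1 := hsad β₀ hβ₀ y hy
      have h2 := Finset.sum_le_sum fun j (_ : j ∈ Finset.univ) =>
        mul_le_mul_of_nonneg_left (hg j) (G.γ_nonneg j)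
      simp only [mul_add, Finset.sum_add_distrib, ← Finset.sum_mul, G.γ_sum,
        one_mul] at h2
      simp only [f, mul_add, Finset.sum_add_distrib] at h1 ⊢
      linarith
    rcases lt_or_ge β L with hβ | hβ
    -- Here `ε ≤ 1` matters: below `L` the expected hinge falls at least as fast as `ε * β` rises.
    · refine hbound L ⟨le_rfl, hLU⟩ (e := ε * (β - L)) (by linarith) fun j => ?_
      have h1 := (hy j (Set.mem_univ j)).2.2.2.2.1
      nlinarith [(hρ' j β).2]
    rcases le_or_gt β U with hβ' | hβ'
    · exact hbound β ⟨hβ, hβ'⟩ (e := 0) (by linarith) fun j => by linarith [(hρ' j β).1]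
    · refine hbound U ⟨hLU, le_rfl⟩ (e := ε * (β - U)) (by linarith) fun j => ?_
      have h1 := (hy j (Set.mem_univ j)).2.2.2.1
      have h2 : 0 ≤ ∫ ξ, max (s * ξ - β) 0 ∂(ρ j) := integral_nonneg fun ξ => le_max_right _ _
      nlinarith
  · choose z hz t ω Ω hmaj hval using fun j => exists_majorant_le_twoPoint (δ := ε * δ)
      (s * G.μ j - b) (hl j) (hr j) (G.variance_nonneg j) (by positivity)
      fun h => mul_pos hε₀ (hδ' ⟨j, h⟩)
    have h1 := hsad b hb z fun j _ => hz j
    have h2 := Finset.sum_le_sum fun j (_ : j ∈ Finset.univ) =>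
      mul_le_mul_of_nonneg_left (hval j) (G.γ_nonneg j)
    rw [mem_socpValues_iff hlo]
    -- The level must be `b`, hence this `β`; the coefficients expand the majorant at `x = s * (ξ -
    -- μ)`, using `s ^ 2 = 1`.
    refine ⟨b - (ε⁻¹ * f b y + δ), fun j => t j - ω j * (s * G.μ j) + Ω j * G.μ j ^ 2,
      fun j => s * ω j - 2 * Ω j * G.μ j, Ω, ?_, fun j => ⟨(hmaj j).1, fun ξ hξ => ?_⟩⟩
    · have e : ∀ j, t j - ω j * (s * G.μ j) + Ω j * G.μ j ^ 2
          + G.μ j * (s * ω j - 2 * Ω j * G.μ j) + (G.variance j + G.μ j ^ 2) * Ω j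
          = t j + G.variance j * Ω j := fun j => by ring
      simp only [e]
      have h3 : ε * (b - (ε⁻¹ * f b y + δ)) = ε * b - f b y - ε * δ := by field_simp; ring
      rw [h3]
      have h4 : ∑ j, G.γ j * ((z j).2 + (s * G.μ j - b) * (z j).1 + ε * δ)
          = f b z - ε * b + ε * δ := by
        simp only [f, mul_add _ _ (ε * δ), Finset.sum_add_distrib, ← Finset.sum_mul, G.γ_sum]
        ring
      linarith
    · have hξ' := (hS ξ).1 hξ
      have h3 := (hmaj j).2 (s * ξ - s * G.μ j) ⟨by linarith [hξ'.1], by linarith [hξ'.2]⟩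
      have e : t j - ω j * (s * G.μ j) + Ω j * G.μ j ^ 2 + (s * ω j - 2 * Ω j * G.μ j) * ξ
          + Ω j * ξ ^ 2
          = t j + ω j * (s * ξ - s * G.μ j) + Ω j * (s * ξ - s * G.μ j) ^ 2 := by
        linear_combination (-(Ω j * (ξ - G.μ j) ^ 2)) * hs
      rw [e]
      exact ⟨h3.1, by linarith [h3.2]⟩

/-! ### From CVaR to the tightened state constraint. -/

theorem cvar_map_const_add (P : Measure ℝ) (ε c x s : ℝ) :
    cvar (P.map fun w => c + w) ε (fun y => s * (y - x)) =
      ⨅ β : ℝ, ((s * (c - x) + (β + ε⁻¹ * ∫ w, max (s * w - β) 0 ∂P) : ℝ) : EReal) := by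
  have hint (β : ℝ) : ∫ y, max (s * (y - x) - β) 0 ∂(P.map fun w => c + w)
      = ∫ w, max (s * w - (β - s * (c - x))) 0 ∂P := by
    rw [integral_map (by fun_prop) (by fun_prop)]
    refine integral_congr_ae (.of_forall fun w => ?_)
    simp only []
    ring_nf
  simp only [cvar, hint]
  refine (Equiv.subRight (s * (c - x))).iInf_congr fun β => ?_
  simp only [Equiv.subRight_apply, EReal.coe_eq_coe_iff]
  ring

/-- The worst-case conditional value-at-risk of a shifted loss, in terms of its optimal value. -/
theorem drCVaRConstraint_iff {G : GaussianMixture} {lo hi ε V c x : ℝ} {i : Fin 2} (hlo : lo ≤ hi)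
    (hε : 0 < ε) (hV : ∃ P ∈ disturbanceAmbiguitySet lo hi G, ∀ β : ℝ,
      V ≤ β + ε⁻¹ * ∫ ξ, max (sideSign i * ξ - β) 0 ∂P)
    (hV' : ∀ δ > 0, V + δ ∈ socpValues G lo hi ε i) :
    DRCVaRConstraint (shiftedAmbiguitySet c (disturbanceAmbiguitySet lo hi G)) ε
      (fun y => sideSign i * (y - x)) ↔ sideSign i * c ≤ sideSign i * x - V := by
  simp only [DRCVaRConstraint, shiftedAmbiguitySet, iSup_le_iff, Set.forall_mem_image,
    cvar_map_const_add]
  constructor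
  · intro h
    obtain ⟨P, hP, hPV⟩ := hV
    have h1 : ((sideSign i * (c - x) + V : ℝ) : EReal) ≤ ((0 : ℝ) : EReal) :=
      (le_iInf fun β => EReal.coe_le_coe_iff.2 (by linarith [hPV β])).trans (h hP)
    rw [EReal.coe_le_coe_iff] at h1
    linarith
  · intro h P hP
    -- `V` itself may be infeasible, so weak duality is applied at `V + δ`.
    refine EReal.le_of_forall_lt_iff_le.1 fun δ hδ => ?_
    have hδ' : 0 < δ := by exact_mod_cast hδ
    obtain ⟨β, hβ⟩ := exists_cvar_le_of_mem_socpValues hlo hε (hV' δ hδ')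
    exact (iInf_le _ β).trans (EReal.coe_le_coe_iff.2 (by linarith [hβ P hP]))

theorem isGLB_socpValues {G : GaussianMixture} {lo hi ε V : ℝ} {i : Fin 2} (hlo : lo ≤ hi)
    (hε : 0 < ε) (hV : ∃ P ∈ disturbanceAmbiguitySet lo hi G, ∀ β : ℝ,
      V ≤ β + ε⁻¹ * ∫ ξ, max (sideSign i * ξ - β) 0 ∂P)
    (hV' : ∀ δ > 0, V + δ ∈ socpValues G lo hi ε i) : IsGLB (socpValues G lo hi ε i) V := by
  obtain ⟨P, hP, hPV⟩ := hV
  refine ⟨fun η hη => ?_, fun b hb => le_of_forall_pos_le_add fun δ hδ => hb (hV' δ hδ)⟩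
  obtain ⟨β, hβ⟩ := exists_cvar_le_of_mem_socpValues hlo hε hη
  exact (hPV β).trans (hβ P hP)

theorem sideSign_zero : sideSign 0 = -1 := by simp [sideSign]

theorem sideSign_one : sideSign 1 = 1 := by simp [sideSign]

/-- Reflecting the support on the lower side lets one argument serve both sides. -/
theorem exists_signed_support (lo hi : ℝ) (hlo : lo ≤ hi) (i : Fin 2) : sideSign i ^ 2 = 1 ∧
    ∃ L U : ℝ, L ≤ U ∧ ∀ ξ, ξ ∈ Set.Icc lo hi ↔ sideSign i * ξ ∈ Set.Icc L U := by
  fin_cases i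
  · simp only [Fin.zero_eta, sideSign_zero]
    refine ⟨by norm_num, -hi, -lo, by linarith, fun ξ => ?_⟩
    simp [and_comm]
  · simp only [Fin.mk_one, sideSign_one]
    exact ⟨by norm_num, lo, hi, hlo, fun ξ => by simp⟩

theorem GaussianMixture.nonempty_index (G : GaussianMixture) : Nonempty (Fin G.M) := by
  by_contra h
  rw [not_nonempty_iff] at h
  simpa using G.γ_sum

theorem tightening_spec {G : GaussianMixture} {lo hi ε : ℝ} (i : Fin 2)
    (hμ : ∀ j, G.μ j ∈ Set.Icc lo hi) (hε₀ : 0 < ε) (hε₁ : ε ≤ 1) :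
    IsGLB (socpValues G lo hi ε i) (tightening G lo hi ε i) ∧
    ((∀ j, 0 < G.variance j) →
      IsLeast (socpValues G lo hi ε i) (tightening G lo hi ε i)) ∧
    ∀ c x : ℝ, DRCVaRConstraint (shiftedAmbiguitySet c (disturbanceAmbiguitySet lo hi G)) ε
      (fun y => sideSign i * (y - x)) ↔
        sideSign i * c ≤ sideSign i * x - tightening G lo hi ε i := by
  obtain ⟨j₀⟩ := G.nonempty_index
  have hlo : lo ≤ hi := (hμ j₀).1.trans (hμ j₀).2
  obtain ⟨hs, L, U, hLU, hS⟩ := exists_signed_support lo hi hlo i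
  obtain ⟨V, hV, hV'⟩ := exists_worst_case hμ hε₀ hε₁ hs hS hLU hlo
  have hpos : ∀ δ > 0, V + δ ∈ socpValues G lo hi ε i := fun δ hδ => hV' δ hδ.le fun _ => hδ
  have hglb := isGLB_socpValues hlo hε₀ hV hpos
  -- Feasibility of `V + 1` makes the set nonempty, so `sInf` is not a default value.
  have hVeq : tightening G lo hi ε i = V := hglb.csInf_eq ⟨_, hpos 1 one_pos⟩
  rw [hVeq]
  refine ⟨hglb, fun hvar => ⟨?_, hglb.1⟩, fun c x => drCVaRConstraint_iff hlo hε₀ hV hpos⟩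
  simpa using hV' 0 le_rfl fun ⟨j, hj⟩ => absurd hj (hvar j).ne'

theorem theorem1 {n m : ℕ}
    (A : Matrix (Fin n) (Fin n) ℝ) (B : Matrix (Fin n) (Fin m) ℝ) (K : Matrix (Fin m) (Fin n) ℝ)
    (wb xb : Fin 2 → Fin n → ℝ)
    (pred : (Fin n → ℝ) → Fin n → GaussianMixture)
    (ε : ℝ) (hε₀ : 0 < ε) (hε₁ : ε ≤ 1)
    (xt s₀ s₁ : Fin n → ℝ) (v₀ : Fin m → ℝ)
    (hs₁ : s₁ = A *ᵥ s₀ + B *ᵥ v₀)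
    (hμ : ∀ τ j, (pred xt τ).μ j ∈ Set.Icc (wb 0 τ) (wb 1 τ))
    (η : Fin 2 → Fin n → ℝ)
    (hη : ∀ i τ, η i τ = tightening (pred xt τ) (wb 0 τ) (wb 1 τ) ε i) :
    (∀ (τ : Fin n) (i : Fin 2),
      IsGLB (socpValues (pred xt τ) (wb 0 τ) (wb 1 τ) ε i) (η i τ) ∧
      ((∀ j, 0 < (pred xt τ).variance j) →
        IsLeast (socpValues (pred xt τ) (wb 0 τ) (wb 1 τ) ε i) (η i τ)) ∧
      (firstStateDRCVaR A B K wb xb pred ε xt s₀ v₀ τ i ↔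
        sideSign i * (s₁ τ + ((A + B * K) *ᵥ (xt - s₀)) τ) ≤ sideSign i * xb i τ - η i τ)) ∧
    ((∀ (τ : Fin n) (i : Fin 2), firstStateDRCVaR A B K wb xb pred ε xt s₀ v₀ τ i) ↔
      s₁ + (A + B * K) *ᵥ (xt - s₀) ∈ Set.Icc (xb 0 + η 0) (xb 1 - η 1)) := by
  have hstate : (A + B * K) *ᵥ xt - (B * K) *ᵥ s₀ + B *ᵥ v₀ = s₁ + (A + B * K) *ᵥ (xt - s₀) := by
    rw [hs₁, mulVec_sub, add_mulVec A (B * K) s₀]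
    abel
  have hmain (τ : Fin n) (i : Fin 2) : firstStateDRCVaR A B K wb xb pred ε xt s₀ v₀ τ i ↔
      sideSign i * (s₁ τ + ((A + B * K) *ᵥ (xt - s₀)) τ) ≤ sideSign i * xb i τ - η i τ := by
    rw [hη, firstStateDRCVaR, hstate]
    exact (tightening_spec i (hμ τ) hε₀ hε₁).2.2 _ _
  refine ⟨fun τ i => ⟨?_, ?_, hmain τ i⟩, ?_⟩
  · rw [hη]
    exact (tightening_spec i (hμ τ) hε₀ hε₁).1
  · rw [hη]
    exact (tightening_spec i (hμ τ) hε₀ hε₁).2.1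
  · simp only [hmain, Fin.forall_fin_two, sideSign_zero, sideSign_one, Set.mem_Icc, Pi.le_def,
      Pi.add_apply, Pi.sub_apply, forall_and]
    refine and_congr (forall_congr' fun τ => ?_) (forall_congr' fun τ => ?_) <;>
      constructor <;> intro h <;> linarith
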